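/- Let $V=\{v_0,v_1,v_2,\ldots\}$ be an alphabet, $V_0\subseteq V$ any subset, and $\mathbb{Q}\langle V\rangle$ the free associative algebra on $V$ (concatenation product, empty word $\mathbf 1$), with the shuffle coproduct $\Delta_{⧢}$, the algebra morphism with $\Delta_{⧢}(v)=v\otimes\mathbf 1+\mathbf 1\otimes v$ for $v\in V$; write $\Delta_{⧢}(A)=A_{(1)}\otimes A_{(2)}$. Let $S$ be its antipode, i.e. the linear anti-automorphism with $S(v)=-v$ for $v\in V$. Let $\mathrm{Lie}(V)\subset\mathbb{Q}\langle V\rangle$ be the free Lie algebra on $V$, whose universal enveloping algebra is $\mathbb{Q}\langle V\rangle$. Let $\triangleright_I:\mathrm{Lie}(V)\otimes\mathrm{Lie}(V)\to\mathrm{Lie}(V)$ be the bilinear map such that, for each $t\in \mathrm{Lie}(V)$, $t\triangleright_I(-)$ is the derivation of $\mathrm{Lie}(V)$ with $t\triangleright_I v=0$ for $v\in V_0$ and $t\triangleright_I v=[v,t]$ for $v\in V\setminus V_0$. Extend it to the unique bilinear map $\triangleright_I:\mathbb{Q}\langle V\rangle\otimes\mathbb{Q}\langle V\rangle\to\mathbb{Q}\langle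 V\rangle$ with $$x\triangleright_I\mathbf 1=0,\quad \mathbf 1\triangleright_I A=A,\quad xA\triangleright_I y=x\triangleright_I(A\triangleright_I y)-(x\triangleright_I A)\triangleright_I y,\quad A\triangleright_I BC=(A_{(1)}\triangleright_I B)(A_{(2)}\triangleright_I C)$$ for $x,y\in\mathrm{Lie}(V)$ and $A,B,C\in\mathbb{Q}\langle V\rangle$, and let $A\circledast_I B=A_{(1)}(A_{(2)}\triangleright_I B)$ be the associated Grossman–Larson product. Let $(-\mid-)$ be the bilinear pairing on $\mathbb{Q}\langle V\rangle$ for which words are orthonormal, and let $(A\otimes B\mid C\otimes D)=(A\mid C)(B\mid D)$. Let $⧢$ be the shuffle product on $\mathbb{Q}\langle V\rangle$. For $v\in V$ let $\mathbb{I}(-;v)$ be the linear endomorphism of $\mathbb{Q}\langle V\rangle$ that is the identity if $v\notin V_0$, and that sends $\mathbf 1$ to $\mathbf 1$ and every nonempty word to $0$ if $v\in V_0$. **Theorem.** There is a unique linear map $\Delta_I:\mathbb{Q}\langle V\rangle\to\mathbb{Q}\langle V\rangle\otimes\mathbb{Q}\langle V\rangle$ with $(A\circledast_I B\mid C)=(A\otimes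 B\mid\Delta_I(C))$ for all $A,B,C\in\mathbb{Q}\langle V\rangle$, and for all $n\ge 0$ and letters $a_1,\ldots,a_n\in V$ it satisfies $$\Delta_I(a_1\cdots a_n)=\sum_{\substack{0\le k\le n\\ 0\le i_1<j_1\le i_2<j_2\le\cdots\le i_k<j_k\le n}}\Big(a_1\cdots a_{i_1}⧢\mathbb{I}\big(S(a_{i_1+1}\cdots a_{j_1-1})⧢a_{j_1+1}\cdots a_{i_2};a_{j_1}\big)⧢\cdots⧢\mathbb{I}\big(S(a_{i_k+1}\cdots a_{j_k-1})⧢a_{j_k+1}\cdots a_{i_{k+1}};a_{j_k}\big)\Big)\otimes a_{j_1}\cdots a_{j_k},$$ where $i_{k+1}:=n$ (so the term for $k=0$ is $a_1\cdots a_n\otimes\mathbf 1$). -/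

import Mathlib

open scoped TensorProduct

attribute [local instance] LieRing.ofAssociativeRing LieAlgebra.ofAssociativeAlgebra

namespace Ihara

/-! ### The algebra `ℚ⟨V⟩` of the alphabet `V = {v₀, v₁, v₂, …}` -/

/-- The free associative noncommutative algebra `ℚ⟨V⟩` with the concatenation product. -/
abbrev QV : Type := FreeAlgebra ℚ ℕ

/-- The letter `v_i`, seen in `ℚ⟨V⟩`. -/
noncomputable def letter (i : ℕ) : QV := FreeAlgebra.ι ℚ i

/-- The word `v_{l₁} ⋯ v_{l_r}`, seen in `ℚ⟨V⟩`. -/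
noncomputable def word (l : List ℕ) : QV := (l.map letter).prod

/-- The basis of `ℚ⟨V⟩` that consists of all words. -/
noncomputable def wordBasis : Module.Basis (FreeMonoid ℕ) ℚ QV := FreeAlgebra.basisFreeMonoid ℚ ℕ

theorem wordBasis_apply (w : FreeMonoid ℕ) : wordBasis w = word w.toList := by
  have h : wordBasis w =
      (FreeAlgebra.equivMonoidAlgebraFreeMonoid (R := ℚ) (X := ℕ)).symm
        (MonoidAlgebra.single w 1) := rfl
  rw [h]
  simp [FreeAlgebra.equivMonoidAlgebraFreeMonoid, MonoidAlgebra.lift_single, FreeMonoid.lift_apply,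
    word]
  rfl

/-! ### The Hopf algebra structure with concatenation and the shuffle coproduct -/

/-- The shuffle coproduct: the algebra morphism with `a ↦ a ⊗ 1 + 1 ⊗ a` on letters. -/
noncomputable def shuffleCoproduct : QV →ₐ[ℚ] QV ⊗[ℚ] QV :=
  FreeAlgebra.lift ℚ fun i => letter i ⊗ₜ[ℚ] 1 + 1 ⊗ₜ[ℚ] letter i

/-- The counit: the algebra morphism that vanishes on letters. -/
noncomputable def counit : QV →ₐ[ℚ] ℚ := FreeAlgebra.lift ℚ fun _ => 0

/-- The antipode: the linear anti-automorphism of `ℚ⟨V⟩` with `S(a) = -a` on letters. -/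
noncomputable def antipode : QV →ₗ[ℚ] QV :=
  (MulOpposite.opLinearEquiv ℚ).symm.toLinearMap ∘ₗ
    (FreeAlgebra.lift ℚ fun i => MulOpposite.op (-letter i) : QV →ₐ[ℚ] QVᵐᵒᵖ).toLinearMap

/-- The free Lie algebra `Lie(V)`, as the Lie subalgebra of `ℚ⟨V⟩` generated by the letters. -/
noncomputable def LieV : LieSubalgebra ℚ QV := LieSubalgebra.lieSpan ℚ QV (Set.range letter)

@[simp] theorem shuffleCoproduct_letter (i : ℕ) :
    shuffleCoproduct (letter i) = letter i ⊗ₜ[ℚ] 1 + 1 ⊗ₜ[ℚ] letter i := by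
  simp [shuffleCoproduct, letter]

@[simp] theorem counit_letter (i : ℕ) : counit (letter i) = 0 := by simp [counit, letter]

theorem antipode_one : antipode 1 = 1 := by simp [antipode]

theorem antipode_letter (i : ℕ) : antipode (letter i) = -letter i := by simp [antipode, letter]

theorem antipode_mul (A B : QV) : antipode (A * B) = antipode B * antipode A := by
  simp [antipode]

/-! ### The Ihara post-Lie product on `Lie(V)` -/

section
open Classical in
/-- For `t ∈ ℚ⟨V⟩`, the algebra map `B ↦ B + ε D_t(B)` to the square-zero extension of `ℚ⟨V⟩`, for
the derivation `D_t` with `D_t(v) = 0` for `v ∈ V₀` and `D_t(v) = [v, t]` for `v ∉ V₀`. -/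
noncomputable def derivationHom (V₀ : Set ℕ) (t : QV) : QV →ₐ[ℚ] TrivSqZeroExt QV QV :=
  FreeAlgebra.lift ℚ fun i =>
    TrivSqZeroExt.inl (letter i) +
      TrivSqZeroExt.inr (if i ∈ V₀ then 0 else letter i * t - t * letter i)
end

theorem fst_derivationHom (V₀ : Set ℕ) (t B : QV) : (derivationHom V₀ t B).fst = B := by
  have h : (TrivSqZeroExt.fstHom ℚ QV QV).comp (derivationHom V₀ t) = AlgHom.id ℚ QV := by
    ext i
    by_cases hi : i ∈ V₀ <;> simp [derivationHom, letter, hi]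
  exact DFunLike.congr_fun h B

/-- The derivation `D_t` of `ℚ⟨V⟩`. -/
noncomputable def derFun (V₀ : Set ℕ) (t B : QV) : QV := (derivationHom V₀ t B).snd

theorem derFun_mul (V₀ : Set ℕ) (t A B : QV) :
    derFun V₀ t (A * B) = derFun V₀ t A * B + A * derFun V₀ t B := by
  simp [derFun, fst_derivationHom, add_comm]

theorem derFun_algebraMap (V₀ : Set ℕ) (t : QV) (r : ℚ) : derFun V₀ t (algebraMap ℚ QV r) = 0 := by
  rw [derFun, AlgHom.commutes]
  simp [TrivSqZeroExt.algebraMap_eq_inl']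

theorem derFun_letter_mem (V₀ : Set ℕ) (t : QV) {i : ℕ} (hi : i ∈ V₀) :
    derFun V₀ t (letter i) = 0 := by
  simp [derFun, derivationHom, letter, hi]

theorem derFun_letter_notMem (V₀ : Set ℕ) (t : QV) {i : ℕ} (hi : i ∉ V₀) :
    derFun V₀ t (letter i) = letter i * t - t * letter i := by
  simp [derFun, derivationHom, letter, hi]

theorem derFun_add_right (V₀ : Set ℕ) (t A B : QV) :
    derFun V₀ t (A + B) = derFun V₀ t A + derFun V₀ t B := by
  simp [derFun]

theorem derFun_smul_right (V₀ : Set ℕ) (t A : QV) (r : ℚ) :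
    derFun V₀ t (r • A) = r • derFun V₀ t A := by
  simp [derFun]

theorem derFun_add_left (V₀ : Set ℕ) (s t B : QV) :
    derFun V₀ (s + t) B = derFun V₀ s B + derFun V₀ t B := by
  induction B using FreeAlgebra.induction with
  | grade0 r => simp [derFun_algebraMap]
  | grade1 i =>
    change derFun V₀ _ (letter i) = derFun V₀ _ (letter i) + derFun V₀ _ (letter i)
    by_cases hi : i ∈ V₀
    · simp [derFun_letter_mem, hi]
    · simp only [derFun_letter_notMem, hi, not_false_eq_true]
      noncomm_ring
  | mul a b ha hb => simp only [derFun_mul, ha, hb]; noncomm_ring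
  | add a b ha hb => simp only [derFun_add_right, ha, hb]; abel

theorem derFun_smul_left (V₀ : Set ℕ) (r : ℚ) (t B : QV) :
    derFun V₀ (r • t) B = r • derFun V₀ t B := by
  induction B using FreeAlgebra.induction with
  | grade0 r => simp [derFun_algebraMap]
  | grade1 i =>
    change derFun V₀ _ (letter i) = r • derFun V₀ _ (letter i)
    by_cases hi : i ∈ V₀
    · simp [derFun_letter_mem, hi]
    · simp [derFun_letter_notMem, hi, smul_sub]
  | mul a b ha hb => simp only [derFun_mul, ha, hb]; simp [smul_add]
  | add a b ha hb => simp only [derFun_add_right, ha, hb]; simp [smul_add]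

/-- The derivations `D_t`, as a bilinear map `(t, B) ↦ D_t(B)`. -/
noncomputable def der (V₀ : Set ℕ) : QV →ₗ[ℚ] QV →ₗ[ℚ] QV :=
  LinearMap.mk₂ ℚ (derFun V₀) (derFun_add_left V₀) (derFun_smul_left V₀)
    (derFun_add_right V₀) fun r t A => derFun_smul_right V₀ t A r

theorem letter_mem_LieV (i : ℕ) : letter i ∈ LieV := LieSubalgebra.subset_lieSpan ⟨i, rfl⟩

theorem bracket_mem_LieV {x y : QV} (hx : x ∈ LieV) (hy : y ∈ LieV) : x * y - y * x ∈ LieV :=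
  LieV.lie_mem hx hy

theorem der_mem_LieV (V₀ : Set ℕ) {t x : QV} (ht : t ∈ LieV) (hx : x ∈ LieV) :
    der V₀ t x ∈ LieV := by
  induction hx using LieSubalgebra.lieSpan_induction with
  | mem y h =>
    obtain ⟨i, rfl⟩ := h
    change derFun V₀ t (letter i) ∈ LieV
    by_cases hi : i ∈ V₀
    · rw [derFun_letter_mem V₀ t hi]; exact LieV.zero_mem
    · rw [derFun_letter_notMem V₀ t hi]
      exact bracket_mem_LieV (letter_mem_LieV i) ht
  | zero => rw [map_zero]; exact LieV.zero_mem
  | add u v _ _ hu hv => rw [map_add]; exact LieV.add_mem hu hv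
  | smul r u _ hu => rw [map_smul]; exact LieV.smul_mem r hu
  | lie u v hu' hv' hu hv =>
    have h : der V₀ t ⁅u, v⁆ =
        (der V₀ t u * v - v * der V₀ t u) + (u * der V₀ t v - der V₀ t v * u) := by
      change derFun V₀ t (u * v - v * u) = (derFun V₀ t u * v - v * derFun V₀ t u) +
        (u * derFun V₀ t v - derFun V₀ t v * u)
      have hsub : derFun V₀ t (u * v - v * u) = derFun V₀ t (u * v) - derFun V₀ t (v * u) :=
        map_sub (der V₀ t) _ _
      rw [hsub, derFun_mul, derFun_mul]
      abel
    rw [h]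
    exact LieV.add_mem (bracket_mem_LieV hu hv') (bracket_mem_LieV hu' hv)

/-- The Ihara post-Lie product on `Lie(V)` relative to `V₀ ⊆ V`: for each `t`, the map `t ▷ -` is
the derivation of the Lie algebra `Lie(V)` with `t ▷ v = 0` for letters `v ∈ V₀` and
`t ▷ v = [v, t]` for letters `v ∉ V₀`. -/
noncomputable def iharaTriangle (V₀ : Set ℕ) : LieV →ₗ[ℚ] LieV →ₗ[ℚ] LieV :=
  LinearMap.mk₂ ℚ (fun t x => ⟨der V₀ t x, der_mem_LieV V₀ t.2 x.2⟩)
    (fun s t x => Subtype.ext (by simp)) (fun r t x => Subtype.ext (by simp))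
    (fun t x y => Subtype.ext (by simp)) (fun r t x => Subtype.ext (by simp))

theorem iharaTriangle_letter_mem (V₀ : Set ℕ) (t : LieV) {i : ℕ} (hi : i ∈ V₀) :
    iharaTriangle V₀ t ⟨letter i, letter_mem_LieV i⟩ = 0 :=
  Subtype.ext (derFun_letter_mem V₀ t hi)

theorem iharaTriangle_letter_notMem (V₀ : Set ℕ) (t : LieV) {i : ℕ} (hi : i ∉ V₀) :
    iharaTriangle V₀ t ⟨letter i, letter_mem_LieV i⟩ = ⁅(⟨letter i, letter_mem_LieV i⟩ : LieV), t⁆ :=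
  Subtype.ext (derFun_letter_notMem V₀ t hi)

theorem iharaTriangle_lie (V₀ : Set ℕ) (t x y : LieV) :
    iharaTriangle V₀ t ⁅x, y⁆ = ⁅iharaTriangle V₀ t x, y⁆ + ⁅x, iharaTriangle V₀ t y⁆ := by
  apply Subtype.ext
  change der V₀ t ((x : QV) * y - y * x) = (der V₀ t x * (y : QV) - y * der V₀ t x) +
    ((x : QV) * der V₀ t y - der V₀ t y * x)
  rw [map_sub]
  change derFun V₀ t (x * y) - derFun V₀ t (y * x) = (derFun V₀ t x * (y : QV) - y * derFun V₀ t x) +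
    ((x : QV) * derFun V₀ t y - derFun V₀ t y * x)
  rw [derFun_mul, derFun_mul]
  abel

/-! ### The extension of a post-Lie product to the enveloping algebra `ℚ⟨V⟩` of `Lie(V)` -/

/-- `e` is the extension to `ℚ⟨V⟩ = U(Lie(V))` of the product `tri` on `Lie(V)`: in Sweedler notation
for the shuffle coproduct, `x ▷ 1 = 0`, `1 ▷ A = A`, `xA ▷ y = x ▷ (A ▷ y) - (x ▷ A) ▷ y` and
`A ▷ BC = (A₍₁₎ ▷ B)(A₍₂₎ ▷ C)`, for `x, y ∈ Lie(V)` and `A, B, C ∈ ℚ⟨V⟩`. -/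
structure IsPostLieExtension (tri : LieV →ₗ[ℚ] LieV →ₗ[ℚ] LieV) (e : QV →ₗ[ℚ] QV →ₗ[ℚ] QV) :
    Prop where
  restrict : ∀ x y : LieV, e x y = tri x y
  lie_one : ∀ x : LieV, e x 1 = 0
  one_left : ∀ A : QV, e 1 A = A
  mul_lie : ∀ (x y : LieV) (A : QV), e (x * A) y = e x (e A y) - e (e x A) y
  right_mul : ∀ A B C : QV, e A (B * C) =
    LinearMap.mul' ℚ QV (TensorProduct.map (e.flip B) (e.flip C) (shuffleCoproduct A))


theorem QV_induction {P : QV → Prop} (one : P 1) (letter : ∀ i, P (letter i))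
    (mul : ∀ a b, P a → P b → P (a * b)) (add : ∀ a b, P a → P b → P (a + b))
    (smul : ∀ (r : ℚ) a, P a → P (r • a)) (A : QV) : P A := by
  induction A using FreeAlgebra.induction with
  | grade0 r => rw [Algebra.algebraMap_eq_smul_one]; exact smul r 1 one
  | grade1 i => exact letter i
  | mul a b ha hb => exact mul a b ha hb
  | add a b ha hb => exact add a b ha hb

/-- `ℚ⟨V⟩` as a bialgebra, with concatenation and the shuffle coproduct. -/
noncomputable instance : Bialgebra ℚ QV :=
  Bialgebra.ofAlgHom shuffleCoproduct counit
    (by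
      ext i
      change _ = Algebra.TensorProduct.map (.id ℚ QV) shuffleCoproduct (shuffleCoproduct (letter i))
      change Algebra.TensorProduct.assoc ℚ ℚ ℚ QV QV QV
        (Algebra.TensorProduct.map shuffleCoproduct (.id ℚ QV) (shuffleCoproduct (letter i))) = _
      simp [TensorProduct.add_tmul, TensorProduct.tmul_add, Algebra.TensorProduct.one_def, add_assoc])
    (by
      ext i
      change Algebra.TensorProduct.map counit (.id ℚ QV) (shuffleCoproduct (letter i)) =
        (1 : ℚ) ⊗ₜ[ℚ] letter i
      simp)
    (by
      ext i
      change Algebra.TensorProduct.map (.id ℚ QV) counit (shuffleCoproduct (letter i)) =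
        letter i ⊗ₜ[ℚ] (1 : ℚ)
      simp)

theorem comul_eq (A : QV) : Coalgebra.comul (R := ℚ) A = shuffleCoproduct A := rfl

theorem counit_eq (A : QV) : Coalgebra.counit (R := ℚ) A = counit A := rfl

theorem shuffleCoproduct_of_mem {x : QV} (hx : x ∈ LieV) :
    shuffleCoproduct x = x ⊗ₜ[ℚ] 1 + 1 ⊗ₜ[ℚ] x := by
  induction hx using LieSubalgebra.lieSpan_induction with
  | mem y h => obtain ⟨i, rfl⟩ := h; simp
  | zero => simp
  | add u v _ _ hu hv => rw [map_add, hu, hv, TensorProduct.add_tmul, TensorProduct.tmul_add]; abel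
  | smul r u _ hu =>
    rw [map_smul, hu, smul_add, TensorProduct.smul_tmul', ← TensorProduct.tmul_smul]
  | lie u v _ _ hu hv =>
    rw [Ring.lie_def, map_sub, map_mul, map_mul, hu, hv]
    simp only [mul_add, add_mul, Algebra.TensorProduct.tmul_mul_tmul, mul_one, one_mul,
      TensorProduct.sub_tmul, TensorProduct.tmul_sub]
    abel

theorem counit_of_mem {x : QV} (hx : x ∈ LieV) : counit x = 0 := by
  induction hx using LieSubalgebra.lieSpan_induction with
  | mem y h => obtain ⟨i, rfl⟩ := h; simp
  | zero => simp
  | add u v _ _ hu hv => simp [hu, hv]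
  | smul r u _ hu => simp [hu]
  | lie u v _ _ hu hv => simp [Ring.lie_def, hu]

theorem der_mul (V₀ : Set ℕ) (t A B : QV) :
    der V₀ t (A * B) = der V₀ t A * B + A * der V₀ t B := derFun_mul V₀ t A B

theorem der_one (V₀ : Set ℕ) (t : QV) : der V₀ t 1 = 0 := by
  have h : derFun V₀ t (algebraMap ℚ QV 1) = 0 := derFun_algebraMap V₀ t 1
  rw [map_one] at h
  exact h

theorem counit_der (V₀ : Set ℕ) {t : QV} (ht : t ∈ LieV) (A : QV) : counit (der V₀ t A) = 0 := by
  induction A using QV_induction with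
  | one => simp [der_one]
  | letter i => exact counit_of_mem (der_mem_LieV V₀ ht (letter_mem_LieV i))
  | mul a b ha hb => simp [der_mul, ha, hb]
  | add a b ha hb => simp [ha, hb]
  | smul r a ha => simp [ha]

/-- `D ⊗ 1 + 1 ⊗ D`. -/
noncomputable def leib (D : QV →ₗ[ℚ] QV) : QV ⊗[ℚ] QV →ₗ[ℚ] QV ⊗[ℚ] QV :=
  TensorProduct.map D LinearMap.id + TensorProduct.map LinearMap.id D

theorem leib_tmul (D : QV →ₗ[ℚ] QV) (a b : QV) :
    leib D (a ⊗ₜ[ℚ] b) = D a ⊗ₜ[ℚ] b + a ⊗ₜ[ℚ] D b := rfl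

theorem leib_mul {D : QV →ₗ[ℚ] QV} (hD : ∀ a b, D (a * b) = D a * b + a * D b)
    (z w : QV ⊗[ℚ] QV) : leib D (z * w) = leib D z * w + z * leib D w := by
  induction z using TensorProduct.induction_on with
  | zero => simp
  | add z z' hz hz' => simp only [add_mul, map_add, hz, hz']; abel
  | tmul a b =>
    induction w using TensorProduct.induction_on with
    | zero => simp
    | add w w' hw hw' => simp only [mul_add, map_add, hw, hw']; abel
    | tmul c d =>
      simp only [Algebra.TensorProduct.tmul_mul_tmul, leib_tmul, hD, TensorProduct.add_tmul,
        TensorProduct.tmul_add, mul_add, add_mul]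
      abel

theorem shuffleCoproduct_der (V₀ : Set ℕ) {t : QV} (ht : t ∈ LieV) (A : QV) :
    shuffleCoproduct (der V₀ t A) = leib (der V₀ t) (shuffleCoproduct A) := by
  induction A using QV_induction with
  | one => simp [der_one, Algebra.TensorProduct.one_def, leib_tmul]
  | letter i =>
    rw [shuffleCoproduct_of_mem (der_mem_LieV V₀ ht (letter_mem_LieV i))]
    simp [leib_tmul, der_one]
  | mul a b ha hb => rw [der_mul, map_add, map_mul, map_mul, ha, hb, map_mul, leib_mul (der_mul V₀ t)]
  | add a b ha hb => simp [ha, hb]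
  | smul r a ha => simp [ha]

/-- The operator `A ↦ xA + D_x(A)`. -/
noncomputable def mulDer (V₀ : Set ℕ) (x : QV) : QV →ₗ[ℚ] QV := LinearMap.mulLeft ℚ x + der V₀ x

theorem mulDer_apply (V₀ : Set ℕ) (x A : QV) : mulDer V₀ x A = x * A + der V₀ x A := rfl

theorem shuffleCoproduct_mulDer (V₀ : Set ℕ) {x : QV} (hx : x ∈ LieV) (A : QV) :
    shuffleCoproduct (mulDer V₀ x A) = leib (mulDer V₀ x) (shuffleCoproduct A) := by
  rw [mulDer_apply, map_add, map_mul, shuffleCoproduct_der V₀ hx, shuffleCoproduct_of_mem hx]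
  induction shuffleCoproduct A using TensorProduct.induction_on with
  | zero => simp
  | add z z' hz hz' => rw [map_add, map_add, ← hz, ← hz', mul_add]; abel
  | tmul a b =>
    simp only [leib_tmul, mulDer_apply, add_mul, Algebra.TensorProduct.tmul_mul_tmul, one_mul,
      TensorProduct.add_tmul, TensorProduct.tmul_add]
    abel

/-- Iterated right brackets: `a₁ ⋯ aₙ ↦ (z ↦ [⋯[[z, a₁], a₂], ⋯, aₙ])`. -/
noncomputable def rightBracket : QV →ₐ[ℚ] (Module.End ℚ QV)ᵐᵒᵖ :=
  FreeAlgebra.lift ℚ fun i =>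
    MulOpposite.op (LinearMap.mulRight ℚ (letter i) - LinearMap.mulLeft ℚ (letter i))

theorem rightBracket_of_mem {x : QV} (hx : x ∈ LieV) (z : QV) :
    (rightBracket x).unop z = z * x - x * z := by
  induction hx using LieSubalgebra.lieSpan_induction generalizing z with
  | mem y h => obtain ⟨i, rfl⟩ := h; simp [rightBracket, letter]
  | zero => simp
  | add u v _ _ hu hv => simp [hu, hv, mul_add, add_mul]; abel
  | smul r u _ hu => simp [hu, smul_sub]
  | lie u v _ _ hu hv =>
    rw [Ring.lie_def]
    simp only [map_sub, map_mul, MulOpposite.unop_sub, MulOpposite.unop_mul, LinearMap.sub_apply,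
      Module.End.mul_apply, hu, hv]
    noncomm_ring

section
open Classical in
/-- The map `A ↦ A ▷ v` for a letter `v`. -/
noncomputable def onLetter (V₀ : Set ℕ) (i : ℕ) : QV →ₗ[ℚ] QV :=
  if i ∈ V₀ then counit.toLinearMap.smulRight (letter i)
  else LinearMap.applyₗ (letter i) ∘ₗ (MulOpposite.opLinearEquiv ℚ).symm.toLinearMap ∘ₗ
    rightBracket.toLinearMap
end

theorem onLetter_mem {V₀ : Set ℕ} {i : ℕ} (hi : i ∈ V₀) (A : QV) :
    onLetter V₀ i A = counit A • letter i := by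
  simp [onLetter, hi]

theorem onLetter_notMem {V₀ : Set ℕ} {i : ℕ} (hi : i ∉ V₀) (A : QV) :
    onLetter V₀ i A = (rightBracket A).unop (letter i) := by
  simp [onLetter, hi]

theorem der_rightBracket {V₀ : Set ℕ} {x : QV} (hx : x ∈ LieV) (A z : QV)
    (hz : der V₀ x z = z * x - x * z) :
    der V₀ x ((rightBracket A).unop z) = (rightBracket (mulDer V₀ x A)).unop z := by
  have key : ∀ A z : QV, der V₀ x ((rightBracket A).unop z) =
      (rightBracket A).unop (der V₀ x z) + (rightBracket (der V₀ x A)).unop z := by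
    intro A
    induction A using QV_induction with
    | one => simp [der_one]
    | letter i =>
      intro z
      rw [rightBracket_of_mem (der_mem_LieV V₀ hx (letter_mem_LieV i)),
        rightBracket_of_mem (letter_mem_LieV i), rightBracket_of_mem (letter_mem_LieV i), map_sub,
        der_mul, der_mul]
      abel
    | mul a b ha hb => intro z; simp [der_mul, ha, hb, add_assoc]
    | add a b ha hb => intro z; simp [ha, hb]; abel
    | smul r a ha => intro z; simp [ha]
  rw [key, hz, mulDer_apply, map_add, map_mul]
  simp [rightBracket_of_mem hx]

theorem der_onLetter {V₀ : Set ℕ} {x : QV} (hx : x ∈ LieV) (i : ℕ) (A : QV) :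
    der V₀ x (onLetter V₀ i A) = onLetter V₀ i (mulDer V₀ x A) := by
  by_cases hi : i ∈ V₀
  · rw [onLetter_mem hi, onLetter_mem hi, map_smul, mulDer_apply, map_add, map_mul,
      counit_of_mem hx, counit_der V₀ hx]
    simp [show der V₀ x (letter i) = 0 from derFun_letter_mem V₀ x hi]
  · rw [onLetter_notMem hi, onLetter_notMem hi]
    exact der_rightBracket hx A _ (derFun_letter_notMem V₀ x hi)

/-- `B ↦ (A ↦ A ▷ B)`, multiplicative for the convolution product. -/
noncomputable def convHom (V₀ : Set ℕ) : QV →ₐ[ℚ] WithConv (QV →ₗ[ℚ] QV) :=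
  FreeAlgebra.lift ℚ fun i => WithConv.toConv (onLetter V₀ i)

theorem convHom_letter (V₀ : Set ℕ) (i : ℕ) :
    convHom V₀ (letter i) = WithConv.toConv (onLetter V₀ i) := by
  simp [convHom, letter]

theorem convHom_mul (V₀ : Set ℕ) (A B C : QV) : (convHom V₀ (B * C)).ofConv A =
    LinearMap.mul' ℚ QV (TensorProduct.map (convHom V₀ B).ofConv (convHom V₀ C).ofConv
      (shuffleCoproduct A)) := by
  rw [map_mul]; rfl

theorem convHom_one (V₀ : Set ℕ) (A : QV) : (convHom V₀ 1).ofConv A = algebraMap ℚ QV (counit A) := by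
  rw [map_one]; rfl

theorem convHom_one_left (V₀ : Set ℕ) (B : QV) : (convHom V₀ B).ofConv 1 = B := by
  induction B using QV_induction with
  | one => simp
  | letter i =>
    rw [convHom_letter]
    by_cases hi : i ∈ V₀
    · simp [onLetter_mem hi]
    · simp [onLetter_notMem hi]
  | mul a b ha hb => rw [convHom_mul]; simp [Algebra.TensorProduct.one_def, ha, hb]
  | add a b ha hb => simp [ha, hb]
  | smul r a ha => simp [ha]

theorem mul'_leib {D f g P : QV →ₗ[ℚ] QV} (hD : ∀ a b, D (a * b) = D a * b + a * D b)
    (hf : ∀ a, D (f a) = f (P a)) (hg : ∀ a, D (g a) = g (P a)) (z : QV ⊗[ℚ] QV) :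
    D (LinearMap.mul' ℚ QV (TensorProduct.map f g z)) =
      LinearMap.mul' ℚ QV (TensorProduct.map f g (leib P z)) := by
  induction z using TensorProduct.induction_on with
  | zero => simp
  | add z z' hz hz' => simp only [map_add, hz, hz']
  | tmul a b => simp [leib_tmul, hD, hf, hg]

theorem der_convHom {V₀ : Set ℕ} {x : QV} (hx : x ∈ LieV) (B A : QV) :
    der V₀ x ((convHom V₀ B).ofConv A) = (convHom V₀ B).ofConv (mulDer V₀ x A) := by
  induction B using QV_induction generalizing A with
  | one =>
    rw [convHom_one, convHom_one, mulDer_apply, map_add, map_mul, counit_of_mem hx,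
      counit_der V₀ hx, Algebra.algebraMap_eq_smul_one, map_smul, der_one]
    simp
  | letter i => rw [convHom_letter]; exact der_onLetter hx i A
  | mul a b ha hb =>
    rw [convHom_mul, convHom_mul, shuffleCoproduct_mulDer V₀ hx]
    exact mul'_leib (der_mul V₀ x) ha hb _
  | add a b ha hb => simp [ha, hb]
  | smul r a ha => simp [ha]

theorem convHom_lie {V₀ : Set ℕ} {x : QV} (hx : x ∈ LieV) (B : QV) :
    (convHom V₀ B).ofConv x = der V₀ x B := by
  have h := der_convHom (V₀ := V₀) hx B 1
  rw [convHom_one_left, mulDer_apply, der_one, mul_one, add_zero] at h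
  exact h.symm

/-- The bilinear map `(A, B) ↦ A ▷ B` that is used to show that the extension exists. -/
noncomputable def extensionWitness (V₀ : Set ℕ) : QV →ₗ[ℚ] QV →ₗ[ℚ] QV :=
  LinearMap.flip ((WithConv.linearEquiv ℚ (QV →ₗ[ℚ] QV)).toLinearMap ∘ₗ (convHom V₀).toLinearMap)

theorem extensionWitness_apply (V₀ : Set ℕ) (A B : QV) :
    extensionWitness V₀ A B = (convHom V₀ B).ofConv A := rfl

theorem isPostLieExtension_witness (V₀ : Set ℕ) :
    IsPostLieExtension (iharaTriangle V₀) (extensionWitness V₀) where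
  restrict x y := convHom_lie x.2 y
  lie_one x := (convHom_lie x.2 1).trans (der_one V₀ x)
  one_left A := convHom_one_left V₀ A
  mul_lie x y A := by
    have h := der_convHom (V₀ := V₀) x.2 y A
    rw [mulDer_apply, map_add] at h
    have h1 : extensionWitness V₀ x (extensionWitness V₀ A y) =
      der V₀ x ((convHom V₀ (y : QV)).ofConv A) := convHom_lie x.2 _
    have h2 : extensionWitness V₀ x A = der V₀ x A := convHom_lie x.2 _
    rw [h1, h2, h]
    simp [extensionWitness_apply]
  right_mul A B C := convHom_mul V₀ A B C

theorem word_cons (i : ℕ) (l : List ℕ) : word (i :: l) = letter i * word l := by simp [word]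

theorem word_induction {P : QV → Prop} (word : ∀ l, P (word l))
    (add : ∀ a b, P a → P b → P (a + b)) (smul : ∀ (r : ℚ) a, P a → P (r • a)) (A : QV) : P A := by
  have hA : A ∈ Submodule.span ℚ (Set.range wordBasis) := by simp
  refine Submodule.span_induction (p := fun A _ => P A) ?_ ?_ ?_ ?_ hA
  · rintro _ ⟨w, rfl⟩
    rw [wordBasis_apply]
    exact word _
  · simpa using smul 0 _ (word [])
  · exact fun a b _ _ => add a b
  · exact fun r a _ => smul r a

/-- The elements of `ℚ⟨V⟩ ⊗ ℚ⟨V⟩` of total degree `n`. -/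
def tensorDegree (n : ℕ) : Submodule ℚ (QV ⊗[ℚ] QV) :=
  Submodule.span ℚ {z | ∃ u v : List ℕ, u.length + v.length = n ∧ z = word u ⊗ₜ[ℚ] word v}

theorem shuffleCoproduct_word_mem (l : List ℕ) :
    shuffleCoproduct (word l) ∈ tensorDegree l.length := by
  induction l with
  | nil =>
    refine Submodule.subset_span ⟨[], [], rfl, ?_⟩
    simp [word, Algebra.TensorProduct.one_def]
  | cons i l ih =>
    rw [word_cons, map_mul, shuffleCoproduct_letter]
    refine Submodule.span_induction (p := fun z _ =>
      (letter i ⊗ₜ[ℚ] 1 + 1 ⊗ₜ[ℚ] letter i) * z ∈ tensorDegree (i :: l).length) ?_ ?_ ?_ ?_ ih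
    · rintro _ ⟨u, v, h, rfl⟩
      rw [add_mul, Algebra.TensorProduct.tmul_mul_tmul, Algebra.TensorProduct.tmul_mul_tmul, one_mul,
        one_mul, ← word_cons, ← word_cons]
      refine add_mem (Submodule.subset_span ⟨i :: u, v, ?_, rfl⟩)
        (Submodule.subset_span ⟨u, i :: v, ?_, rfl⟩) <;> simp only [List.length_cons] <;> omega
    · simp
    · intro a b _ _ ha hb
      rw [mul_add]
      exact add_mem ha hb
    · intro r a _ ha
      rw [mul_smul_comm]
      exact Submodule.smul_mem _ r ha

theorem eq_zero_of_conv {g : QV →ₗ[ℚ] QV} (h1 : g 1 = 0)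
    (hg : ∀ A, g A = -LinearMap.mul' ℚ QV (TensorProduct.map g g (shuffleCoproduct A))) (A : QV) :
    g A = 0 := by
  have key : ∀ n, ∀ l : List ℕ, l.length = n → g (word l) = 0 := by
    intro n
    induction n using Nat.strong_induction_on with
    | _ n ih =>
      intro l hl
      rw [hg, neg_eq_zero]
      have hz := shuffleCoproduct_word_mem l
      rw [hl] at hz
      refine Submodule.span_induction (p := fun z _ =>
        LinearMap.mul' ℚ QV (TensorProduct.map g g z) = 0) ?_ ?_ ?_ ?_ hz
      · rintro _ ⟨u, v, h, rfl⟩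
        rw [TensorProduct.map_tmul, LinearMap.mul'_apply]
        by_cases hu : u.length < n
        · rw [ih _ hu u rfl, zero_mul]
        · have hv : v = [] := List.length_eq_zero_iff.1 (by omega)
          rw [hv, show word [] = 1 from rfl, h1, mul_zero]
      · simp
      · intro a b _ _ ha hb
        rw [map_add, map_add, ha, hb, add_zero]
      · intro r a _ ha
        rw [map_smul, map_smul, ha, smul_zero]
  induction A using word_induction with
  | word l => exact key _ l rfl
  | add a b ha hb => rw [map_add, ha, hb, add_zero]
  | smul r a ha => rw [map_smul, ha, smul_zero]

theorem IsPostLieExtension.right_one {tri : LieV →ₗ[ℚ] LieV →ₗ[ℚ] LieV}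
    {e : QV →ₗ[ℚ] QV →ₗ[ℚ] QV} (h : IsPostLieExtension tri e) (A : QV) :
    e A 1 = algebraMap ℚ QV (counit A) := by
  let η : QV →ₗ[ℚ] QV := Algebra.linearMap ℚ QV ∘ₗ counit.toLinearMap
  let f : WithConv (QV →ₗ[ℚ] QV) := WithConv.toConv (e.flip 1)
  have hη : WithConv.toConv η = 1 := rfl
  have hf : f * f = f := by
    ext A
    have := h.right_mul A 1 1
    rw [mul_one] at this
    exact this.symm
  have hg : (f - 1) = -((f - 1) * (f - 1)) := by
    rw [mul_sub, sub_mul, hf]; simp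
  have := eq_zero_of_conv (g := (f - 1).ofConv) ?_ (fun A => ?_) A
  · have h' : e A 1 - η A = 0 := this
    exact sub_eq_zero.1 h'
  · change e 1 1 - η 1 = 0
    rw [h.one_left]
    simp [η]
  · conv_lhs => rw [hg]
    rfl

theorem IsPostLieExtension.lie_left {V₀ : Set ℕ} {e : QV →ₗ[ℚ] QV →ₗ[ℚ] QV}
    (h : IsPostLieExtension (iharaTriangle V₀) e) {x : QV} (hx : x ∈ LieV) (B : QV) :
    e x B = der V₀ x B := by
  induction B using QV_induction with
  | one => rw [der_one]; exact h.lie_one ⟨x, hx⟩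
  | letter i => exact h.restrict ⟨x, hx⟩ ⟨letter i, letter_mem_LieV i⟩
  | mul a b ha hb =>
    rw [h.right_mul, shuffleCoproduct_of_mem hx, der_mul, ← ha, ← hb]
    simp [h.one_left]
  | add a b ha hb => simp [ha, hb]
  | smul r a ha => simp [ha]

/-- The span of the products of `n` elements of `Lie(V)`. -/
def lieProducts (n : ℕ) : Submodule ℚ QV :=
  Submodule.span ℚ {z | ∃ l : List QV, (∀ x ∈ l, x ∈ LieV) ∧ l.length = n ∧ z = l.prod}

theorem mul_mem_lieProducts {x A : QV} {n : ℕ} (hx : x ∈ LieV) (hA : A ∈ lieProducts n) :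
    x * A ∈ lieProducts (n + 1) := by
  refine Submodule.span_induction (p := fun A _ => x * A ∈ lieProducts (n + 1)) ?_ ?_ ?_ ?_ hA
  · rintro _ ⟨l, hl, rfl, rfl⟩
    exact Submodule.subset_span ⟨x :: l, by simpa using ⟨hx, hl⟩, by simp, by simp⟩
  · simp
  · intro a b _ _ ha hb
    rw [mul_add]
    exact add_mem ha hb
  · intro r a _ ha
    rw [mul_smul_comm]
    exact Submodule.smul_mem _ r ha

theorem der_prod_mem (V₀ : Set ℕ) {x : QV} (hx : x ∈ LieV) (l : List QV) (hl : ∀ y ∈ l, y ∈ LieV) :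
    der V₀ x l.prod ∈ lieProducts l.length := by
  induction l with
  | nil => simp [der_one]
  | cons y l ih =>
    rw [List.forall_mem_cons] at hl
    rw [List.prod_cons, der_mul]
    exact add_mem
      (mul_mem_lieProducts (der_mem_LieV V₀ hx hl.1) (Submodule.subset_span ⟨l, hl.2, rfl, rfl⟩))
      (mul_mem_lieProducts hl.1 (ih hl.2))

theorem IsPostLieExtension.unique {V₀ : Set ℕ} {e e' : QV →ₗ[ℚ] QV →ₗ[ℚ] QV}
    (h : IsPostLieExtension (iharaTriangle V₀) e)
    (h' : IsPostLieExtension (iharaTriangle V₀) e') : e = e' := by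
  have key : ∀ n, ∀ A ∈ lieProducts n, ∀ y ∈ LieV, e A y = e' A y := by
    intro n
    induction n with
    | zero =>
      intro A hA y hy
      refine Submodule.span_induction (p := fun A _ => e A y = e' A y) ?_ ?_ ?_ ?_ hA
      · rintro _ ⟨l, -, hl, rfl⟩
        rw [List.length_eq_zero_iff.1 hl, List.prod_nil, h.one_left, h'.one_left]
      · simp
      · intro a b _ _ ha hb
        simp [ha, hb]
      · intro r a _ ha
        simp [ha]
    | succ n ih =>
      intro A hA y hy
      refine Submodule.span_induction (p := fun A _ => e A y = e' A y) ?_ ?_ ?_ ?_ hA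
      · rintro _ ⟨l, hl, hn, rfl⟩
        obtain ⟨x, l, rfl⟩ := List.exists_cons_of_length_eq_add_one hn
        rw [List.forall_mem_cons] at hl
        have hln : l.length = n := by simpa using hn
        have hd := der_prod_mem V₀ hl.1 l hl.2
        rw [hln] at hd
        rw [List.prod_cons]
        have e1 := h.mul_lie ⟨x, hl.1⟩ ⟨y, hy⟩ l.prod
        have e2 := h'.mul_lie ⟨x, hl.1⟩ ⟨y, hy⟩ l.prod
        simp only [h.lie_left hl.1] at e1
        simp only [h'.lie_left hl.1] at e2
        rw [e1, e2, ih _ hd y hy, ih l.prod (Submodule.subset_span ⟨l, hl.2, hln, rfl⟩) y hy]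
      · simp
      · intro a b _ _ ha hb
        simp [ha, hb]
      · intro r a _ ha
        simp [ha]
  have onLie : ∀ A, ∀ y ∈ LieV, e A y = e' A y := by
    intro A y hy
    induction A using word_induction with
    | word l =>
      refine key l.length _ (Submodule.subset_span ⟨l.map letter, ?_, by simp, rfl⟩) y hy
      intro x hx
      obtain ⟨i, -, rfl⟩ := List.mem_map.1 hx
      exact letter_mem_LieV i
    | add a b ha hb => simp [ha, hb]
    | smul r a ha => simp [ha]
  have all : ∀ B, e.flip B = e'.flip B := by
    intro B
    induction B using QV_induction with
    | one => ext1 A; simp [h.right_one, h'.right_one]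
    | letter i => ext1 A; exact onLie A _ (letter_mem_LieV i)
    | mul a b ha hb =>
      ext1 A
      change e A (a * b) = e' A (a * b)
      rw [h.right_mul, h'.right_mul, ha, hb]
    | add a b ha hb => simp [ha, hb]
    | smul r a ha => simp [ha]
  ext1 A
  ext1 B
  exact DFunLike.congr_fun (all B) A

theorem existsUnique_extension (V₀ : Set ℕ) : ∃! e, IsPostLieExtension (iharaTriangle V₀) e :=
  ⟨extensionWitness V₀, isPostLieExtension_witness V₀, fun _ h =>
    h.unique (isPostLieExtension_witness V₀)⟩

/-- The extended product `▷_I : ℚ⟨V⟩ ⊗ ℚ⟨V⟩ → ℚ⟨V⟩`: the unique extension of the Ihara post-Lie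
product on `Lie(V)` to the enveloping algebra. -/
noncomputable def triangle (V₀ : Set ℕ) : QV →ₗ[ℚ] QV →ₗ[ℚ] QV :=
  Classical.choose (existsUnique_extension V₀).exists

theorem triangle_spec (V₀ : Set ℕ) : IsPostLieExtension (iharaTriangle V₀) (triangle V₀) :=
  Classical.choose_spec (existsUnique_extension V₀).exists

/-- The Grossman-Larson product `A ⊛_I B = A₍₁₎ (A₍₂₎ ▷_I B)`. -/
noncomputable def glProduct (V₀ : Set ℕ) (A B : QV) : QV :=
  LinearMap.mul' ℚ QV
    (TensorProduct.map LinearMap.id ((triangle V₀).flip B) (shuffleCoproduct A))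

/-! ### Duality -/

section
open Classical in
/-- The pairing `(- ∣ -)` on `ℚ⟨V⟩` for which the words are orthonormal, so that `(A ∣ w)` is the
coefficient of the word `w` in `A`. -/
noncomputable def pairing : QV →ₗ[ℚ] QV →ₗ[ℚ] ℚ := wordBasis.toDual
end

/-- The pairing `(A ⊗ B ∣ C ⊗ D) = (A ∣ C)(B ∣ D)` on `ℚ⟨V⟩ ⊗ ℚ⟨V⟩`. -/
noncomputable def tensorPairing : QV ⊗[ℚ] QV →ₗ[ℚ] QV ⊗[ℚ] QV →ₗ[ℚ] ℚ :=
  LinearMap.BilinForm.tmul pairing pairing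

theorem tensorPairing_tmul (A B C D : QV) :
    tensorPairing (A ⊗ₜ[ℚ] B) (C ⊗ₜ[ℚ] D) = pairing A C * pairing B D := by
  rw [tensorPairing, LinearMap.BilinForm.tmul, LinearMap.BilinForm.tensorDistrib_tmul, smul_eq_mul,
    mul_comm]

/-- `Δ` is dual to the Grossman-Larson product: `(A ⊛_I B ∣ C) = (A ⊗ B ∣ Δ(C))`. -/
def IsDualCoproduct (V₀ : Set ℕ) (Δ : QV →ₗ[ℚ] QV ⊗[ℚ] QV) : Prop :=
  ∀ A B C : QV, pairing (glProduct V₀ A B) C = tensorPairing (A ⊗ₜ[ℚ] B) (Δ C)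

/-! ### The ingredients of the explicit formula -/

/-- The shuffle product of two words: `1 ⧢ v = v`, `u ⧢ 1 = u` and
`au ⧢ bv = a(u ⧢ bv) + b(au ⧢ v)` for letters `a, b`. -/
noncomputable def shuffleWords : List ℕ → List ℕ → QV
  | [], v => word v
  | a :: u, [] => word (a :: u)
  | a :: u, b :: v => letter a * shuffleWords u (b :: v) + letter b * shuffleWords (a :: u) v
termination_by u v => u.length + v.length

/-- The shuffle product `⧢` on `ℚ⟨V⟩`, extended bilinearly from words. -/
noncomputable def shuffle : QV →ₗ[ℚ] QV →ₗ[ℚ] QV :=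
  wordBasis.constr ℚ fun u => wordBasis.constr ℚ fun v => shuffleWords u.toList v.toList

section
open Classical in
/-- `χ(w, v)`: for `v ∈ V₀` it is `1` if `w` is the empty word and `0` otherwise; for `v ∉ V₀` it
is `1`. -/
noncomputable def chi (V₀ : Set ℕ) (w : FreeMonoid ℕ) (v : ℕ) : ℚ :=
  if v ∈ V₀ then (if w = 1 then 1 else 0) else 1
end

/-- The linear map `𝕀(-; v)` with `𝕀(w; v) = χ(w, v) w` for words `w`. -/
noncomputable def II (V₀ : Set ℕ) (v : ℕ) : QV →ₗ[ℚ] QV :=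
  wordBasis.constr ℚ fun w => chi V₀ w v • wordBasis w

/-- The subword `a_{s+1} a_{s+2} ⋯ a_t` of `a₁ ⋯ aₙ` (empty if `t ≤ s`). The function `a` is indexed
from `0`, so that `a 0` is the first letter `a₁`. -/
noncomputable def segment {n : ℕ} (a : Fin n → ℕ) (s t : ℕ) : QV :=
  word (((List.ofFn a).take t).drop s)

/-- The index set of the formula for fixed `n` and `k`: pairs of sequences `(i₁, …, i_{k+1})` in
`{0, …, n}` and `(j₁, …, j_k)` in `{1, …, n}` with
`0 ≤ i₁ < j₁ ≤ i₂ < j₂ ≤ ⋯ ≤ i_k < j_k ≤ i_{k+1} = n`. The index `j_p` is represented by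
`j_p - 1 ∈ Fin n`, which is the position of the letter `a_{j_p}` when letters are counted from `0`;
hence `i_p < j_p` reads `i_p ≤ j_p - 1` and `j_p ≤ i_{p+1}` reads `j_p - 1 < i_{p+1}`. -/
def indices (n k : ℕ) : Finset ((Fin (k + 1) → Fin (n + 1)) × (Fin k → Fin n)) :=
  {x | (∀ p : Fin k, (x.1 p.castSucc : ℕ) ≤ x.2 p ∧ (x.2 p : ℕ) < x.1 p.succ) ∧
    x.1 (Fin.last k) = Fin.last n}

/-- The left tensor factor
`a₁ ⋯ a_{i₁} ⧢ 𝕀(S(a_{i₁+1} ⋯ a_{j₁-1}) ⧢ a_{j₁+1} ⋯ a_{i₂}; a_{j₁}) ⧢ ⋯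
  ⧢ 𝕀(S(a_{i_k+1} ⋯ a_{j_k-1}) ⧢ a_{j_k+1} ⋯ a_{i_{k+1}}; a_{j_k})`. -/
noncomputable def leftFactor (V₀ : Set ℕ) {n k : ℕ} (a : Fin n → ℕ) (i : Fin (k + 1) → Fin (n + 1))
    (j : Fin k → Fin n) : QV :=
  (List.ofFn fun p : Fin k =>
    II V₀ (a (j p)) (shuffle (antipode (segment a (i p.castSucc) (j p)))
      (segment a (j p + 1) (i p.succ)))).foldl (fun A B => shuffle A B) (segment a 0 (i 0))

/-- The right tensor factor `a_{j₁} ⋯ a_{j_k}`. -/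
noncomputable def rightFactor {n k : ℕ} (a : Fin n → ℕ) (j : Fin k → Fin n) : QV :=
  word (List.ofFn fun p => a (j p))

end Ihara

/-!
The product `A ▷_I B` is multiplicative in `B` with respect to convolution (`triangle_eq`), so for a
word `b₁ ⋯ b_k`
`A ⊛_I b₁ ⋯ b_k = A₍₀₎ (A₍₁₎ ▷ b₁) ⋯ (A₍ₖ₎ ▷ b_k)`,
or, one letter at a time, `A ⊛_I (B b) = (A₍₁₎ ⊛_I B)(A₍₂₎ ▷ b)` (`glProduct_mul_letter`). On a letter,
`A ▷ b = S(A'₍₁₎) b A'₍₂₎` with `A' = 𝕀(A; b)` (`onLetter_eq`): for `b ∉ V₀` this is an iterated bracket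
`[⋯[b, a₁], ⋯, aₙ]`, and for `b ∈ V₀` it is the constant term of `A` times `b`.

To read off the coefficient of a word in such a product, cut the word in all possible ways
(`pairing_mul_segment`), move `S` and `𝕀(-; b)` to the other side of the pairing, where both are
self-adjoint (`pairing_antipode`, `pairing_II`), and turn the shuffle coproduct into the shuffle product
(`tensorPairing_shuffleCoproduct`). The factor `A ▷ b` contributes `𝕀(S(u) ⧢ v; b)` for each way `u b v`
to cut its block at a letter `b` (`pairing_onLetter_segment`), and induction on `k` gives the
coefficient of every prefix (`pairing_glProduct_segment`). The index sequences `i`, `j` of the formula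
record the cuts.

Hence the explicit formula has the required pairing with every `A ⊗ B`
(`tensorPairing_explicitCoproduct`). Defining `Δ_I` by it on words proves existence, and since the
pairing on the tensor square is nondegenerate (`eq_of_tensorPairing`), uniqueness and the formula
follow.
-/

namespace Ihara

/-! ### Duality of concatenation and shuffle with their coproducts -/

theorem pairing_word (u v : List ℕ) : pairing (word u) (word v) = if u = v then 1 else 0 := by
  classical
  have h := wordBasis.toDual_apply (FreeMonoid.ofList u) (FreeMonoid.ofList v)
  simp only [wordBasis_apply, FreeMonoid.toList_ofList, EmbeddingLike.apply_eq_iff_eq] at h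
  rw [pairing]
  convert h

theorem pairing_letter_mul (a b : ℕ) (A B : QV) :
    pairing (letter a * A) (letter b * B) = if a = b then pairing A B else 0 := by
  induction A using word_induction with
  | word u =>
    induction B using word_induction with
    | word v =>
      rw [← word_cons, ← word_cons, pairing_word, pairing_word]
      by_cases h : a = b <;> simp [h]
    | add B C hB hC => rw [mul_add, map_add, hB, hC, map_add]; split_ifs <;> simp
    | smul r B hB => rw [mul_smul_comm, map_smul, hB, map_smul]; split_ifs <;> simp
  | add A C hA hC =>
    rw [mul_add, map_add, LinearMap.add_apply, hA, hC, map_add, LinearMap.add_apply]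
    split_ifs <;> simp
  | smul r A hA =>
    rw [mul_smul_comm, map_smul, LinearMap.smul_apply, hA, map_smul, LinearMap.smul_apply]
    split_ifs <;> simp

theorem pairing_one_left (A : QV) : pairing 1 A = counit A := by
  induction A using word_induction with
  | word u =>
    rw [show (1 : QV) = word [] from rfl, pairing_word]
    cases u <;> simp [word]
  | add A B hA hB => rw [map_add, hA, hB, map_add]
  | smul r A hA => rw [map_smul, hA, map_smul]

theorem pairing_one_right (A : QV) : pairing A 1 = counit A := by
  induction A using word_induction with
  | word u =>
    rw [show (1 : QV) = word [] from rfl, pairing_word]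
    cases u <;> simp [word]
  | add A B hA hB => rw [map_add, LinearMap.add_apply, hA, hB, map_add]
  | smul r A hA => rw [map_smul, LinearMap.smul_apply, hA, map_smul]

/-- Concatenation is dual to deconcatenation. -/
theorem pairing_mul_word (A B : QV) (l : List ℕ) :
    pairing (A * B) (word l) =
      ∑ m ∈ Finset.range (l.length + 1), pairing A (word (l.take m)) * pairing B (word (l.drop m)) := by
  induction A using word_induction generalizing l with
  | word u =>
    induction u generalizing l with
    | nil =>
      rw [Finset.sum_range_succ', Finset.sum_eq_zero]
      · rw [pairing_word]; simp [word]
      · intro m hm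
        rw [pairing_word, if_neg, zero_mul]
        have := Finset.mem_range.1 hm
        intro h
        have := congrArg List.length h
        simp at this
        omega
    | cons a u ih =>
      rw [word_cons, mul_assoc]
      cases l with
      | nil => simp [show word [] = 1 from rfl, pairing_one_right]
      | cons c l =>
        rw [word_cons, pairing_letter_mul, List.length_cons, Finset.sum_range_succ']
        simp only [List.take_succ_cons, List.drop_succ_cons, word_cons, pairing_letter_mul,
          List.take_zero, show word [] = 1 from rfl, pairing_one_right]
        split_ifs <;> simp [ih]
  | add A C hA hC =>
    simp only [add_mul, map_add, LinearMap.add_apply, hA, hC, Finset.sum_add_distrib]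
  | smul r A hA =>
    simp only [smul_mul_assoc, map_smul, LinearMap.smul_apply, hA, Finset.smul_sum]

theorem shuffle_word (u v : List ℕ) : shuffle (word u) (word v) = shuffleWords u v := by
  have h (l : List ℕ) : word l = wordBasis (FreeMonoid.ofList l) := by
    rw [wordBasis_apply, FreeMonoid.toList_ofList]
  rw [h u, h v, shuffle, Module.Basis.constr_basis, Module.Basis.constr_basis]
  rfl

theorem tensorPairing_left_letter_mul (a b : ℕ) (z : QV ⊗[ℚ] QV) (C D : QV) :
    tensorPairing ((letter a ⊗ₜ[ℚ] 1) * z) ((letter b * C) ⊗ₜ[ℚ] D) =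
      if a = b then tensorPairing z (C ⊗ₜ[ℚ] D) else 0 := by
  induction z using TensorProduct.induction_on with
  | zero => simp
  | add x y hx hy => rw [mul_add, map_add, LinearMap.add_apply, hx, hy]; split_ifs <;> simp
  | tmul x y =>
    rw [Algebra.TensorProduct.tmul_mul_tmul, tensorPairing_tmul, tensorPairing_tmul,
      pairing_letter_mul]
    split_ifs <;> simp

theorem tensorPairing_right_letter_mul (a b : ℕ) (z : QV ⊗[ℚ] QV) (C D : QV) :
    tensorPairing ((1 ⊗ₜ[ℚ] letter a) * z) (C ⊗ₜ[ℚ] (letter b * D)) =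
      if a = b then tensorPairing z (C ⊗ₜ[ℚ] D) else 0 := by
  induction z using TensorProduct.induction_on with
  | zero => simp
  | add x y hx hy => rw [mul_add, map_add, LinearMap.add_apply, hx, hy]; split_ifs <;> simp
  | tmul x y =>
    rw [Algebra.TensorProduct.tmul_mul_tmul, tensorPairing_tmul, tensorPairing_tmul,
      pairing_letter_mul]
    split_ifs <;> simp

theorem tensorPairing_left_letter_one (a : ℕ) (z : QV ⊗[ℚ] QV) (D : QV) :
    tensorPairing ((letter a ⊗ₜ[ℚ] 1) * z) (1 ⊗ₜ[ℚ] D) = 0 := by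
  induction z using TensorProduct.induction_on with
  | zero => simp
  | add x y hx hy => rw [mul_add, map_add, LinearMap.add_apply, hx, hy, add_zero]
  | tmul x y =>
    rw [Algebra.TensorProduct.tmul_mul_tmul, tensorPairing_tmul, pairing_one_right]
    simp

theorem tensorPairing_right_letter_one (a : ℕ) (z : QV ⊗[ℚ] QV) (C : QV) :
    tensorPairing ((1 ⊗ₜ[ℚ] letter a) * z) (C ⊗ₜ[ℚ] 1) = 0 := by
  induction z using TensorProduct.induction_on with
  | zero => simp
  | add x y hx hy => rw [mul_add, map_add, LinearMap.add_apply, hx, hy, add_zero]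
  | tmul x y =>
    rw [Algebra.TensorProduct.tmul_mul_tmul, tensorPairing_tmul, pairing_one_right]
    simp

/-- The shuffle product is dual to the shuffle coproduct. -/
theorem tensorPairing_shuffleCoproduct (A C D : QV) :
    tensorPairing (shuffleCoproduct A) (C ⊗ₜ[ℚ] D) = pairing A (shuffle C D) := by
  induction C using word_induction with
  | word u =>
    induction D using word_induction with
    | word v =>
      rw [shuffle_word]
      induction A using word_induction with
      | word w =>
        induction w generalizing u v with
        | nil =>
          rw [show word [] = 1 from rfl, map_one, Algebra.TensorProduct.one_def,
            tensorPairing_tmul]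
          simp only [pairing_one_left]
          cases u <;> cases v <;> simp [shuffleWords, word]
        | cons a w ih =>
          rw [word_cons, map_mul, shuffleCoproduct_letter, add_mul, map_add, LinearMap.add_apply]
          have h1 : word [] = 1 := rfl
          cases u with
          | nil =>
            cases v with
            | nil =>
              rw [h1, tensorPairing_left_letter_one, tensorPairing_right_letter_one]
              simp [shuffleWords, h1, pairing_one_right]
            | cons c v =>
              rw [shuffleWords, word_cons, tensorPairing_right_letter_mul, h1,
                tensorPairing_left_letter_one, pairing_letter_mul, ← h1, ih, shuffleWords,
                zero_add]
          | cons b u =>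
            cases v with
            | nil =>
              rw [shuffleWords, word_cons, tensorPairing_left_letter_mul, h1,
                tensorPairing_right_letter_one, pairing_letter_mul, ← h1, ih, add_zero]
              cases u <;> simp [shuffleWords]
            | cons c v =>
              rw [shuffleWords, map_add, pairing_letter_mul, pairing_letter_mul, ← ih, ← ih]
              congr 1
              · rw [word_cons b, tensorPairing_left_letter_mul]
              · rw [word_cons c, tensorPairing_right_letter_mul]
      | add A B hA hB => simp only [map_add, LinearMap.add_apply, hA, hB]
      | smul r A hA => simp only [map_smul, LinearMap.smul_apply, hA]
    | add A B hA hB => simp only [map_add, TensorProduct.tmul_add, hA, hB]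
    | smul r A hA => simp only [map_smul, TensorProduct.tmul_smul, hA]
  | add A B hA hB => simp only [map_add, LinearMap.add_apply, TensorProduct.add_tmul, hA, hB]
  | smul r A hA =>
    simp only [map_smul, LinearMap.smul_apply, ← TensorProduct.smul_tmul', hA]

/-! ### Self-adjointness of `S` and of `𝕀(-; v)` -/

theorem antipode_word (l : List ℕ) : antipode (word l) = (-1 : ℚ) ^ l.length • word l.reverse := by
  induction l with
  | nil => simpa [word] using antipode_one
  | cons a l ih =>
    rw [word_cons, antipode_mul, ih, antipode_letter]
    simp [word, pow_succ]

/-- `S` is self-adjoint: on words it is reversal up to a sign that depends only on the length. -/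
theorem pairing_antipode (A B : QV) : pairing (antipode A) B = pairing A (antipode B) := by
  induction A using word_induction with
  | word u =>
    induction B using word_induction with
    | word v =>
      rw [antipode_word, antipode_word, map_smul, LinearMap.smul_apply, map_smul, pairing_word,
        pairing_word]
      by_cases h : u.reverse = v
      · subst h; simp
      · rw [if_neg h, if_neg (fun h' => h (by rw [h', List.reverse_reverse]))]; simp
    | add A B hA hB => simp only [map_add, hA, hB]
    | smul r A hA => simp only [map_smul, hA]
  | add A B hA hB => simp only [map_add, LinearMap.add_apply, hA, hB]
  | smul r A hA => simp only [map_smul, LinearMap.smul_apply, hA]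

theorem II_of_mem {V₀ : Set ℕ} {i : ℕ} (hi : i ∈ V₀) (A : QV) : II V₀ i A = counit A • 1 := by
  have h : II V₀ i = counit.toLinearMap.smulRight 1 := by
    refine wordBasis.ext fun w => ?_
    rw [II, Module.Basis.constr_basis, chi, if_pos hi]
    induction w using FreeMonoid.casesOn <;> simp [wordBasis_apply, word]
  rw [h]; rfl

theorem II_of_notMem {V₀ : Set ℕ} {i : ℕ} (hi : i ∉ V₀) (A : QV) : II V₀ i A = A := by
  have h : II V₀ i = LinearMap.id := by
    refine wordBasis.ext fun w => ?_
    rw [II, Module.Basis.constr_basis, chi, if_neg hi]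
    simp
  rw [h]; rfl

theorem pairing_II (V₀ : Set ℕ) (i : ℕ) (A B : QV) :
    pairing (II V₀ i A) B = pairing A (II V₀ i B) := by
  by_cases hi : i ∈ V₀
  · rw [II_of_mem hi, II_of_mem hi, map_smul, LinearMap.smul_apply, map_smul, pairing_one_left,
      pairing_one_right, smul_eq_mul, smul_eq_mul, mul_comm]
  · rw [II_of_notMem hi, II_of_notMem hi]

/-! ### The product `▷_I` on letters and the Grossman–Larson product -/

/-- By uniqueness of the extension, `A ▷ B` is the value at `A` of `convHom V₀ B`, which is
multiplicative in `B` for the convolution product. -/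
theorem triangle_eq (V₀ : Set ℕ) (A B : QV) : triangle V₀ A B = (convHom V₀ B).ofConv A := by
  rw [(triangle_spec V₀).unique (isPostLieExtension_witness V₀), extensionWitness_apply]

/-- The iterated bracket `[⋯[[z, a₁], a₂], ⋯, aₙ]` is `S(A₍₁₎) z A₍₂₎` for `A = a₁ ⋯ aₙ`. -/
theorem rightBracket_eq (A z : QV) :
    (rightBracket A).unop z = LinearMap.mul' ℚ QV
      (TensorProduct.map antipode (LinearMap.mulLeft ℚ z) (shuffleCoproduct A)) := by
  have key (l : List ℕ) : (rightBracket (word l)).unop z = LinearMap.mul' ℚ QV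
      (TensorProduct.map antipode (LinearMap.mulLeft ℚ z) (shuffleCoproduct (word l))) := by
    induction l using List.reverseRecOn with
    | nil => simp [word, Algebra.TensorProduct.one_def, antipode_one]
    | append_singleton l i ih =>
      have hl : word (l ++ [i]) = word l * letter i := by simp [word]
      rw [hl, map_mul, MulOpposite.unop_mul, Module.End.mul_apply, ih, map_mul,
        rightBracket_of_mem (letter_mem_LieV i), shuffleCoproduct_letter]
      induction shuffleCoproduct (word l) using TensorProduct.induction_on with
      | zero => simp
      | add x y hx hy => rw [add_mul]; simp only [map_add]; rw [← hx, ← hy]; noncomm_ring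
      | tmul x y => simp [mul_add, antipode_mul, antipode_letter, mul_assoc]; abel
  induction A using word_induction with
  | word l => exact key l
  | add A B hA hB => simp [hA, hB]
  | smul r A hA => simp [hA]

/-- `A ▷ v = S(A₍₁₎) v A₍₂₎` for a letter `v ∉ V₀`; replacing `A` by `𝕀(A; v)` covers `v ∈ V₀` too,
where `A ▷ v` only sees the constant term of `A`. -/
theorem onLetter_eq (V₀ : Set ℕ) (i : ℕ) (A : QV) :
    onLetter V₀ i A = LinearMap.mul' ℚ QV (TensorProduct.map antipode
      (LinearMap.mulLeft ℚ (letter i)) (shuffleCoproduct (II V₀ i A))) := by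
  by_cases hi : i ∈ V₀
  · simp [onLetter_mem hi, II_of_mem hi, Algebra.TensorProduct.one_def, antipode_one]
  · rw [onLetter_notMem hi, II_of_notMem hi, rightBracket_eq]

theorem glProduct_eq (V₀ : Set ℕ) (A B : QV) :
    glProduct V₀ A B = (WithConv.toConv LinearMap.id * convHom V₀ B).ofConv A := by
  have h : (triangle V₀).flip B = (convHom V₀ B).ofConv :=
    LinearMap.ext fun C => triangle_eq V₀ C B
  rw [glProduct, h]
  rfl

theorem glProduct_one (V₀ : Set ℕ) (A : QV) : glProduct V₀ A 1 = A := by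
  rw [glProduct_eq, map_one, mul_one]; rfl

/-- `A ⊛ (B v) = (A₍₁₎ ⊛ B)(A₍₂₎ ▷ v)`, by coassociativity. -/
theorem glProduct_mul_letter (V₀ : Set ℕ) (A B : QV) (i : ℕ) :
    glProduct V₀ A (B * letter i) = LinearMap.mul' ℚ QV (TensorProduct.map
      (WithConv.toConv LinearMap.id * convHom V₀ B).ofConv (onLetter V₀ i)
      (shuffleCoproduct A)) := by
  rw [glProduct_eq, map_mul, ← mul_assoc, convHom_letter]; rfl

/-! ### Nondegeneracy of the pairing on the tensor square -/

/-- The words `u ⊗ v` separate the points of `ℚ⟨V⟩ ⊗ ℚ⟨V⟩`. -/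
theorem eq_of_tensorPairing {z z' : QV ⊗[ℚ] QV} (h : ∀ u v : List ℕ,
    tensorPairing (word u ⊗ₜ[ℚ] word v) z = tensorPairing (word u ⊗ₜ[ℚ] word v) z') : z = z' := by
  classical
  have key (p : FreeMonoid ℕ × FreeMonoid ℕ) : tensorPairing (wordBasis p.1 ⊗ₜ[ℚ] wordBasis p.2) =
      (wordBasis.tensorProduct wordBasis).coord p := by
    refine (wordBasis.tensorProduct wordBasis).ext fun q => ?_
    rw [Module.Basis.coord_apply, Module.Basis.repr_self, Module.Basis.tensorProduct_apply,
      tensorPairing_tmul]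
    simp only [wordBasis_apply, pairing_word, EmbeddingLike.apply_eq_iff_eq, Finsupp.single_apply,
      Prod.ext_iff, ite_and, mul_ite, mul_one, mul_zero, eq_comm]
    split_ifs <;> simp_all
  refine (wordBasis.tensorProduct wordBasis).ext_elem fun p => ?_
  rw [← Module.Basis.coord_apply, ← Module.Basis.coord_apply, ← key, wordBasis_apply,
    wordBasis_apply]
  exact h _ _

/-! ### Coefficients of `A ⊛_I B` at segments of a fixed word -/

section Segments

variable {n : ℕ} (a : Fin n → ℕ)

theorem segment_self (s : ℕ) : segment a s s = 1 := by
  rw [segment, List.drop_eq_nil_of_le (by simp)]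
  rfl

theorem segment_zero_last : segment a 0 n = word (List.ofFn a) := by
  rw [segment, List.drop_zero, List.take_of_length_le (by simp)]

theorem segment_eq_letter_mul (j : Fin n) {t : ℕ} (h : (j : ℕ) < t) :
    segment a j t = letter (a j) * segment a (j + 1) t := by
  rw [segment, segment, List.drop_eq_getElem_cons (by simp; omega), word_cons]
  simp

theorem pairing_mul_segment (A B : QV) {s t : ℕ} (hst : s ≤ t) (ht : t ≤ n) :
    pairing (A * B) (segment a s t) = ∑ m : Fin (n + 1),
      if s ≤ m ∧ (m : ℕ) ≤ t then pairing A (segment a s m) * pairing B (segment a m t) else 0 := by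
  rw [Fin.sum_univ_eq_sum_range (fun m => if s ≤ m ∧ m ≤ t then
    pairing A (segment a s m) * pairing B (segment a m t) else 0), ← Finset.sum_filter]
  have hI : (Finset.range (n + 1)).filter (fun m => s ≤ m ∧ m ≤ t) = Finset.Ico s (t + 1) := by
    ext m; simp; omega
  rw [hI, Finset.sum_Ico_eq_sum_range, segment, pairing_mul_word]
  have hl : (((List.ofFn a).take t).drop s).length + 1 = t + 1 - s := by simp; omega
  rw [hl]
  refine Finset.sum_congr rfl fun m hm => ?_
  have hm := Finset.mem_range.1 hm
  rw [segment, segment, List.drop_drop, List.take_drop, List.take_take, min_eq_left (by omega)]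

/-- The positions of the letter `b` in the segment from `s` to `t`. -/
def positions (s t b : ℕ) : Finset (Fin n) := {j | (s ≤ (j : ℕ) ∧ (j : ℕ) < t) ∧ a j = b}

theorem mem_positions {s t b : ℕ} {j : Fin n} :
    j ∈ positions a s t b ↔ (s ≤ (j : ℕ) ∧ (j : ℕ) < t) ∧ a j = b := by
  simp [positions]

theorem pairing_mul_letter_mul_segment (A B : QV) (b : ℕ) {s t : ℕ} (hst : s ≤ t) (ht : t ≤ n) :
    pairing (A * (letter b * B)) (segment a s t) =
      ∑ j ∈ positions a s t b,
        pairing A (segment a s j) * pairing B (segment a (j + 1) t) := by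
  rw [pairing_mul_segment a _ _ hst ht, positions, Finset.sum_filter, Fin.sum_univ_castSucc]
  -- The letter `b` cannot come from the empty segment that starts at `n`.
  have hlast : (if s ≤ (Fin.last n : ℕ) ∧ (Fin.last n : ℕ) ≤ t then
      pairing A (segment a s (Fin.last n)) * pairing (letter b * B) (segment a (Fin.last n) t)
      else 0) = 0 := by
    split_ifs with h
    · rw [show ((Fin.last n : Fin (n + 1)) : ℕ) = t from le_antisymm h.2 ht, segment_self,
        pairing_one_right, map_mul, counit_letter, zero_mul, mul_zero]
    · rfl
  rw [hlast, add_zero]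
  refine Finset.sum_congr rfl fun j _ => ?_
  rw [Fin.val_castSucc]
  rcases lt_trichotomy (j : ℕ) t with h | h | h
  · rw [segment_eq_letter_mul a j h, pairing_letter_mul]
    by_cases hb : a j = b
    · simp [hb, h, h.le]
    · simp [hb, Ne.symm hb]
  · rw [h, segment_self, pairing_one_right]
    simp
  · rw [if_neg (by omega), if_neg (by omega)]

/-- The left tensor factor contributed by the letter `a_j`, for the block between the positions `s`
and `t`. -/
noncomputable def blockFactor (V₀ : Set ℕ) (s t : ℕ) (j : Fin n) : QV :=
  II V₀ (a j) (shuffle (antipode (segment a s j)) (segment a (j + 1) t))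

/-- The coefficient of a segment in `A ▷ v`, for a letter `v`. -/
theorem pairing_onLetter_segment (V₀ : Set ℕ) (A : QV) (b : ℕ) {s t : ℕ} (hst : s ≤ t)
    (ht : t ≤ n) :
    pairing (onLetter V₀ b A) (segment a s t) =
      ∑ j ∈ positions a s t b, pairing A (blockFactor a V₀ s t j) := by
  have key (z : QV ⊗[ℚ] QV) : pairing (LinearMap.mul' ℚ QV (TensorProduct.map antipode
      (LinearMap.mulLeft ℚ (letter b)) z)) (segment a s t) =
      ∑ j ∈ positions a s t b,
        tensorPairing z (antipode (segment a s j) ⊗ₜ[ℚ] segment a (j + 1) t) := by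
    induction z using TensorProduct.induction_on with
    | zero => simp
    | add x y hx hy => simp only [map_add, LinearMap.add_apply, hx, hy, Finset.sum_add_distrib]
    | tmul x y =>
      rw [TensorProduct.map_tmul, LinearMap.mul'_apply, LinearMap.mulLeft_apply,
        pairing_mul_letter_mul_segment a _ _ _ hst ht]
      simp only [tensorPairing_tmul, pairing_antipode]
  rw [onLetter_eq, key]
  refine Finset.sum_congr rfl fun j hj => ?_
  rw [tensorPairing_shuffleCoproduct, pairing_II, ← ((mem_positions a).1 hj).2, blockFactor]

/-- The interleaved index sequences of `indices`, ending at `m` instead of `n`, that select the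
letters `b₁, …, b_k`. -/
def selections (m : ℕ) {k : ℕ} (b : Fin k → ℕ) :
    Finset ((Fin (k + 1) → Fin (n + 1)) × (Fin k → Fin n)) :=
  {x | ((∀ p : Fin k, (x.1 p.castSucc : ℕ) ≤ x.2 p ∧ (x.2 p : ℕ) < x.1 p.succ) ∧
    (x.1 (Fin.last k) : ℕ) = m) ∧ ∀ p, a (x.2 p) = b p}

theorem mem_selections {m k : ℕ} {b : Fin k → ℕ}
    {x : (Fin (k + 1) → Fin (n + 1)) × (Fin k → Fin n)} : x ∈ selections a m b ↔
      ((∀ p : Fin k, (x.1 p.castSucc : ℕ) ≤ x.2 p ∧ (x.2 p : ℕ) < x.1 p.succ) ∧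
        (x.1 (Fin.last k) : ℕ) = m) ∧ ∀ p, a (x.2 p) = b p := by
  simp [selections]

theorem leftFactor_snoc (V₀ : Set ℕ) {k : ℕ} (i : Fin (k + 2) → Fin (n + 1))
    (j : Fin (k + 1) → Fin n) :
    leftFactor V₀ a i j = shuffle (leftFactor V₀ a (Fin.init i) (Fin.init j))
      (blockFactor a V₀ (i (Fin.last k).castSucc) (i (Fin.last (k + 1))) (j (Fin.last k))) := by
  rw [leftFactor, List.ofFn_succ', List.concat_eq_append, List.foldl_append]
  rfl

/-- A selection of `k + 1` letters is a selection of `k` letters ending at `i_{k+1}`, together with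
the position `j_{k+1}` of the last letter in the segment from `i_{k+1}` to `m`. -/
theorem mem_selections_succ {m k : ℕ} {b : Fin (k + 1) → ℕ}
    (x : (Fin (k + 2) → Fin (n + 1)) × (Fin (k + 1) → Fin n)) :
    x ∈ selections a m b ↔
      (Fin.init x.1, Fin.init x.2) ∈ selections a (x.1 (Fin.last k).castSucc) (Fin.init b) ∧
      x.2 (Fin.last k) ∈ positions a (x.1 (Fin.last k).castSucc) m (b (Fin.last k)) ∧
      (x.1 (Fin.last (k + 1)) : ℕ) = m := by
  simp only [mem_selections, mem_positions, Fin.forall_fin_succ', Fin.init, Fin.succ_last,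
    Fin.succ_castSucc]
  constructor
  · rintro ⟨⟨⟨h1, h2, h3⟩, h4⟩, h5, h6⟩
    exact ⟨⟨⟨h1, trivial⟩, h5⟩, ⟨⟨h2, h4 ▸ h3⟩, h6⟩, h4⟩
  · rintro ⟨⟨⟨h1, -⟩, h5⟩, ⟨⟨h2, h3⟩, h6⟩, h4⟩
    exact ⟨⟨⟨h1, h2, h4 ▸ h3⟩, h4⟩, h5, h6⟩

theorem sum_selections_succ {M : Type*} [AddCommMonoid M] {m k : ℕ} (hm : m ≤ n)
    (b : Fin (k + 1) → ℕ) (f : (Fin (k + 2) → Fin (n + 1)) × (Fin (k + 1) → Fin n) → M) :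
    ∑ x ∈ selections a m b, f x =
      ∑ m' : Fin (n + 1), ∑ x ∈ selections a m' (Fin.init b),
        ∑ j ∈ positions a m' m (b (Fin.last k)),
          f (Fin.snoc x.1 ⟨m, Nat.lt_succ_of_le hm⟩, Fin.snoc x.2 j) := by
  simp only [← Finset.sum_product', Finset.sum_sigma']
  refine Finset.sum_bij' (fun x _ => ⟨x.1 (Fin.last k).castSucc,
      (Fin.init x.1, Fin.init x.2), x.2 (Fin.last k)⟩)
    (fun y _ => (Fin.snoc y.2.1.1 ⟨m, Nat.lt_succ_of_le hm⟩, Fin.snoc y.2.1.2 y.2.2))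
    ?_ ?_ ?_ ?_ ?_
  · intro x hx
    rw [mem_selections_succ] at hx
    simpa using ⟨hx.1, hx.2.1⟩
  · rintro ⟨m', x, j⟩ hy
    simp only [Finset.mem_sigma, Finset.mem_univ, true_and, Finset.mem_product] at hy
    have hl : x.1 (Fin.last k) = m' :=
      Fin.ext ((mem_selections a).1 hy.1).1.2
    rw [mem_selections_succ]
    simpa [hl] using hy
  · intro x hx
    rw [mem_selections_succ] at hx
    have h : (⟨m, Nat.lt_succ_of_le hm⟩ : Fin (n + 1)) = x.1 (Fin.last (k + 1)) :=
      Fin.ext hx.2.2.symm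
    simp [h]
  · rintro ⟨m', x, j⟩ hy
    simp only [Finset.mem_sigma, Finset.mem_univ, true_and, Finset.mem_product] at hy
    have hl : x.1 (Fin.last k) = m' :=
      Fin.ext ((mem_selections a).1 hy.1).1.2
    simp [hl]
  · intro x hx
    rw [mem_selections_succ] at hx
    have h : (⟨m, Nat.lt_succ_of_le hm⟩ : Fin (n + 1)) = x.1 (Fin.last (k + 1)) :=
      Fin.ext hx.2.2.symm
    simp [h]

/-- The coefficient of the prefix `a₁ ⋯ a_m` in `A ⊛_I b₁ ⋯ b_k`. The prefix is allowed to vary, since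
removing the last letter `b_k` leaves a coefficient at a shorter prefix. -/
theorem pairing_glProduct_segment (V₀ : Set ℕ) {m : ℕ} (hm : m ≤ n) {k : ℕ} (b : Fin k → ℕ)
    (A : QV) :
    pairing (glProduct V₀ A (word (List.ofFn b))) (segment a 0 m) =
      ∑ x ∈ selections a m b, pairing A (leftFactor V₀ a x.1 x.2) := by
  induction k generalizing m A with
  | zero =>
    have hs : selections a m b = {(fun _ => ⟨m, Nat.lt_succ_of_le hm⟩, Fin.elim0)} := by
      ext x
      rw [mem_selections, Finset.mem_singleton, Prod.ext_iff, funext_iff]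
      simp [Fin.ext_iff, Subsingleton.elim x.2 Fin.elim0]
    rw [hs, Finset.sum_singleton, List.ofFn_zero, show word [] = 1 from rfl, glProduct_one]
    simp [leftFactor]
  | succ k ih =>
    have hb : word (List.ofFn b) = word (List.ofFn (Fin.init b)) * letter (b (Fin.last k)) := by
      rw [List.ofFn_succ', List.concat_eq_append, word, List.map_append, List.prod_append]
      simp [word, Fin.init_def]
    -- Expand `(A₍₁₎ ⊛ b₁ ⋯ b_k)(A₍₂₎ ▷ b_{k+1})` over the ways to cut the prefix in two, for any tensor
    -- in place of `A₍₁₎ ⊗ A₍₂₎`.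
    have key (z : QV ⊗[ℚ] QV) : pairing (LinearMap.mul' ℚ QV (TensorProduct.map
        (WithConv.toConv LinearMap.id * convHom V₀ (word (List.ofFn (Fin.init b)))).ofConv
        (onLetter V₀ (b (Fin.last k))) z)) (segment a 0 m) =
        ∑ m' : Fin (n + 1), ∑ x ∈ selections a m' (Fin.init b),
          ∑ j ∈ positions a m' m (b (Fin.last k)),
            tensorPairing z (leftFactor V₀ a x.1 x.2 ⊗ₜ[ℚ] blockFactor a V₀ m' m j) := by
      induction z using TensorProduct.induction_on with
      | zero => simp
      | add x y hx hy => simp only [map_add, LinearMap.add_apply, hx, hy, Finset.sum_add_distrib]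
      | tmul A B =>
        rw [TensorProduct.map_tmul, LinearMap.mul'_apply, ← glProduct_eq,
          pairing_mul_segment a _ _ (Nat.zero_le m) hm]
        refine Finset.sum_congr rfl fun m' _ => ?_
        simp only [tensorPairing_tmul]
        split_ifs with h
        · rw [ih (Nat.lt_succ_iff.1 m'.2), pairing_onLetter_segment a V₀ _ _ h.2 hm,
            Finset.sum_mul_sum]
        · refine (Finset.sum_eq_zero fun x _ => Finset.sum_eq_zero fun j hj => ?_).symm
          rw [mem_positions] at hj
          omega
    rw [hb, glProduct_mul_letter, key, sum_selections_succ a hm]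
    refine Finset.sum_congr rfl fun m' _ => Finset.sum_congr rfl fun x hx =>
      Finset.sum_congr rfl fun j _ => ?_
    have hl : x.1 (Fin.last k) = m' := Fin.ext ((mem_selections a).1 hx).1.2
    rw [tensorPairing_shuffleCoproduct, leftFactor_snoc]
    simp [hl]

/-! ### The explicit formula -/

/-- The right-hand side of the explicit formula for `Δ_I(a₁ ⋯ aₙ)`. -/
noncomputable def explicitCoproduct (V₀ : Set ℕ) : QV ⊗[ℚ] QV :=
  ∑ k ∈ Finset.range (n + 1), ∑ x ∈ indices n k, leftFactor V₀ a x.1 x.2 ⊗ₜ[ℚ] rightFactor a x.2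

/-- The positions `j₁ < ⋯ < j_k` are distinct, so that `k ≤ n`. -/
theorem indices_eq_empty {k : ℕ} (h : n < k) : indices n k = ∅ := by
  refine Finset.eq_empty_of_forall_notMem fun x hx => ?_
  simp only [indices, Finset.mem_filter_univ] at hx
  cases k with
  | zero => omega
  | succ k =>
    have hj : StrictMono x.2 := Fin.strictMono_iff_lt_succ.2 fun p => by
      have h1 := (hx.1 p.castSucc).2
      have h2 := (hx.1 p.succ).1
      rw [Fin.succ_castSucc] at h1
      exact Fin.lt_def.2 (h1.trans_le h2)
    have := Fintype.card_le_of_injective _ hj.injective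
    simp only [Fintype.card_fin] at this
    omega

theorem pairing_rightFactor {k l : ℕ} (b : Fin l → ℕ) (j : Fin k → Fin n) :
    pairing (word (List.ofFn b)) (rightFactor a j) =
      if (⟨l, b⟩ : Σ k, Fin k → ℕ) = ⟨k, fun p => a (j p)⟩ then 1 else 0 := by
  classical
  rw [rightFactor, pairing_word]
  simp only [List.ofFn_inj']

theorem tensorPairing_explicitCoproduct (V₀ : Set ℕ) (A : QV) (v : List ℕ) :
    tensorPairing (A ⊗ₜ[ℚ] word v) (explicitCoproduct a V₀) =
      pairing (glProduct V₀ A (word v)) (word (List.ofFn a)) := by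
  obtain ⟨l, b, rfl⟩ : ∃ (l : ℕ) (b : Fin l → ℕ), v = List.ofFn b := ⟨_, v.get, by simp⟩
  have hsel : selections a n b = (indices n l).filter fun x => (fun p => a (x.2 p)) = b := by
    ext x
    simp [mem_selections, indices, funext_iff, Fin.ext_iff]
  rw [← segment_zero_last a, pairing_glProduct_segment a V₀ le_rfl, hsel, explicitCoproduct, map_sum,
    Finset.sum_eq_single l]
  · rw [map_sum, Finset.sum_filter]
    refine Finset.sum_congr rfl fun x _ => ?_
    rw [tensorPairing_tmul, pairing_rightFactor]
    by_cases h : (fun p => a (x.2 p)) = b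
    · simp [h]
    · simp [h, Ne.symm h]
  -- For another number `k` of letters, the right factor is a word of another length than `v`.
  · intro k _ hk
    rw [map_sum]
    refine Finset.sum_eq_zero fun x _ => ?_
    rw [tensorPairing_tmul, pairing_rightFactor, if_neg, mul_zero]
    exact fun h => hk (congrArg Sigma.fst h).symm
  · intro hl
    rw [indices_eq_empty (by simpa using hl), Finset.sum_empty, map_zero]

end Segments

/-- The linear map given on words by the explicit formula is dual to `⊛_I`. -/
theorem isDualCoproduct_constr (V₀ : Set ℕ) :
    IsDualCoproduct V₀ (wordBasis.constr ℚ fun w => explicitCoproduct w.toList.get V₀) := by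
  intro A B C
  induction C using word_induction with
  | word l =>
    have hl : word l = wordBasis (FreeMonoid.ofList l) := by
      rw [wordBasis_apply, FreeMonoid.toList_ofList]
    conv_rhs => rw [hl, Module.Basis.constr_basis]
    induction B using word_induction with
    | word v =>
      rw [tensorPairing_explicitCoproduct, List.ofFn_get, FreeMonoid.toList_ofList]
    | add B D hB hD =>
      rw [TensorProduct.tmul_add, map_add, LinearMap.add_apply, ← hB, ← hD]
      simp [glProduct_eq, mul_add]
    | smul r B hB =>
      rw [TensorProduct.tmul_smul, map_smul, LinearMap.smul_apply, ← hB]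
      simp [glProduct_eq]
  | add C D hC hD => simp only [map_add, hC, hD]
  | smul r C hC => simp only [map_smul, hC]

end Ihara

theorem theorem4p13 (V₀ : Set ℕ) :
    (∃! Δ : Ihara.QV →ₗ[ℚ] Ihara.QV ⊗[ℚ] Ihara.QV, Ihara.IsDualCoproduct V₀ Δ) ∧
    ∀ Δ : Ihara.QV →ₗ[ℚ] Ihara.QV ⊗[ℚ] Ihara.QV, Ihara.IsDualCoproduct V₀ Δ →
      ∀ (n : ℕ) (a : Fin n → ℕ),
        Δ (Ihara.word (List.ofFn a)) =
          ∑ k ∈ Finset.range (n + 1), ∑ x ∈ Ihara.indices n k,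
            Ihara.leftFactor V₀ a x.1 x.2 ⊗ₜ[ℚ] Ihara.rightFactor a x.2 := by
  refine ⟨⟨_, Ihara.isDualCoproduct_constr V₀, fun Δ hΔ => LinearMap.ext fun C =>
    Ihara.eq_of_tensorPairing fun u v => ?_⟩, fun Δ hΔ n a => Ihara.eq_of_tensorPairing fun u v => ?_⟩
  · rw [← hΔ, ← Ihara.isDualCoproduct_constr V₀]
  · rw [← hΔ, ← Ihara.tensorPairing_explicitCoproduct, Ihara.explicitCoproduct]
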